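/- **Homology Nerve Lemma.** Let $R$ be a commutative ring (for instance a field), let $X$ be an abstract simplicial complex (not necessarily finite), and let $\mathcal U=(U_i)_{i\in I}$ be a family of subcomplexes of $X$, indexed by an arbitrary set $I$, with $X=\bigcup_{i\in I}U_i$. Assume that for every nonempty finite set $J\subseteq I$ for which the subcomplex $\bigcap_{j\in J}U_j$ is nonempty, this intersection has trivial reduced simplicial homology with coefficients in $R$ in all degrees. Let $\mathcal N(\mathcal U)$ be the nerve of the family, that is, the abstract simplicial complex whose simplices are the nonempty finite sets $J\subseteq I$ with $\bigcap_{j\in J}U_j\neq\emptyset$. Then the simplicial homology of $X$ and of the nerve are isomorphic: $$H_n(X;R)\cong H_n(\mathcal N(\mathcal U);R)\qquad\text{as } R\text{-modules, for every } n\ge 0.$$ Here simplicial homology is computed from the chain complex that is free on the simplices, with the signs of the boundary map given by any fixed linear orders on the vertex set of $X$ and on $I$. Reduced homology is the homology of this chain complex augmented by the map $C_0\to R$ that sums coefficients. -/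

import Mathlib

open CategoryTheory

universe u v

/-! Simplicial chains, simplicial homology and reduced simplicial homology of an abstract simplicial
complex with coefficients in a commutative ring, and the nerve of a family of subcomplexes. -/

namespace PreAbstractSimplicialComplex

/-- The simplices of dimension `n` of `K`, that is, the faces with exactly `n + 1` vertices. -/
abbrev Simplex {V : Type u} (K : PreAbstractSimplicialComplex V) (n : ℕ) : Type u :=
  {s : Finset V // s ∈ K ∧ s.card = n + 1}

/-- The facet of an `(n + 1)`-simplex `s` opposite to its vertex `v`. -/
def Simplex.facet {V : Type*} [DecidableEq V] {K : PreAbstractSimplicialComplex V} {n : ℕ}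
    (s : K.Simplex (n + 1)) (v : {v : V // v ∈ s.1}) : K.Simplex n :=
  ⟨s.1.erase v.1, by
    have hc : (s.1.erase v.1).card = n + 1 := by
      rw [Finset.card_erase_of_mem v.2, s.2.2]; rfl
    refine ⟨(K.isRelLowerSet_faces s.2.1).2 (Finset.erase_subset _ _) ?_, hc⟩
    exact Finset.card_pos.mp (by omega)⟩

/-- The sign `(-1) ^ i`, where `v` is the `i`-th vertex of `s` (counted from `0`) in increasing
order. -/
def vertexSign {V : Type*} [LinearOrder V] (R : Type*) [CommRing R] (s : Finset V) (v : V) : R :=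
  (-1) ^ (s.filter (· < v)).card

/-- The simplicial boundary `∂ [v₀, …, vₙ₊₁] = ∑ i, (-1) ^ i [v₀, …, v̂ᵢ, …, vₙ₊₁]` for
`v₀ < ⋯ < vₙ₊₁`. -/
noncomputable def boundary {V : Type*} [LinearOrder V] (R : Type*) [CommRing R]
    (K : PreAbstractSimplicialComplex V) (n : ℕ) :
    (K.Simplex (n + 1) →₀ R) →ₗ[R] (K.Simplex n →₀ R) :=
  Finsupp.linearCombination R fun s : K.Simplex (n + 1) =>
    ∑ v ∈ s.1.attach, Finsupp.single (s.facet v) (vertexSign R s.1 v.1)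

/-- The augmentation `C₀ → R`, the sum of the coefficients of a `0`-chain (`R` is lifted to the
universe of the chain modules). -/
noncomputable def augmentation {V : Type u} (R : Type v) [CommRing R]
    (K : PreAbstractSimplicialComplex V) : (K.Simplex 0 →₀ R) →ₗ[R] ULift.{max u v} R :=
  Finsupp.linearCombination R fun _ : K.Simplex 0 => ULift.up (1 : R)

theorem vertexSign_mul_antisymm {V : Type*} [LinearOrder V] (R : Type*) [CommRing R]
    (s : Finset V) {v w : V} (hv : v ∈ s) (hw : w ∈ s) (hvw : v ≠ w) :
    vertexSign R s v * vertexSign R (s.erase v) w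
      + vertexSign R s w * vertexSign R (s.erase w) v = 0 := by
  wlog h : v < w generalizing v w
  · rw [add_comm]
    exact this hw hv hvw.symm (lt_of_le_of_ne (not_lt.mp h) hvw.symm)
  have h1 : ((s.erase w).filter (· < v)) = s.filter (· < v) := by
    ext x; simp only [Finset.mem_filter, Finset.mem_erase]
    refine ⟨fun hx => ⟨hx.1.2, hx.2⟩, fun hx => ⟨⟨?_, hx.1⟩, hx.2⟩⟩
    exact (hx.2.trans h).ne
  have h2 : ((s.erase v).filter (· < w)) = (s.filter (· < w)).erase v := by
    ext x; simp only [Finset.mem_filter, Finset.mem_erase]; tauto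
  have hm : v ∈ s.filter (· < w) := Finset.mem_filter.mpr ⟨hv, h⟩
  have h3 : (s.filter (· < w)).card = ((s.filter (· < w)).erase v).card + 1 :=
    (Finset.card_erase_add_one hm).symm
  unfold vertexSign
  rw [h1, h2, h3]
  ring

theorem boundary_comp_boundary {V : Type*} [LinearOrder V] (R : Type*) [CommRing R]
    (K : PreAbstractSimplicialComplex V) (n : ℕ) :
    K.boundary R n ∘ₗ K.boundary R (n + 1) = 0 := by
  refine Finsupp.lhom_ext' fun s => LinearMap.ext_ring ?_
  simp only [boundary, LinearMap.comp_apply, Finsupp.lsingle_apply,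
    Finsupp.linearCombination_single, one_smul, map_sum, LinearMap.zero_apply]
  simp only [Finset.smul_sum, Finsupp.smul_single, smul_eq_mul]
  rw [Finset.sum_sigma']
  refine Finset.sum_involution
    (fun p _ => ⟨⟨p.2.1, Finset.mem_of_mem_erase p.2.2⟩,
      ⟨p.1.1, Finset.mem_erase.mpr ⟨(Finset.ne_of_mem_erase p.2.2).symm, p.1.2⟩⟩⟩) ?_ ?_ ?_ ?_
  · rintro ⟨⟨v, hv⟩, ⟨w, hw⟩⟩ _
    have hw' := Finset.mem_erase.mp hw
    have e : (s.facet ⟨w, hw'.2⟩).facet ⟨v, Finset.mem_erase.mpr ⟨hw'.1.symm, hv⟩⟩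
        = (s.facet ⟨v, hv⟩).facet ⟨w, hw⟩ := Subtype.ext (Finset.erase_right_comm)
    simp only [e]
    rw [← Finsupp.single_add]
    have := vertexSign_mul_antisymm R s.1 hv hw'.2 hw'.1.symm
    simp only [Simplex.facet] at this ⊢
    rw [this]
    exact Finsupp.single_zero _
  · rintro ⟨⟨v, hv⟩, ⟨w, hw⟩⟩ _ _ h
    have := congrArg (fun p => p.1.1) h
    exact (Finset.ne_of_mem_erase hw) this
  · rintro ⟨⟨v, hv⟩, ⟨w, hw⟩⟩ _
    exact Finset.mem_sigma.mpr ⟨Finset.mem_attach _ _, Finset.mem_attach _ _⟩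
  · rintro ⟨⟨v, hv⟩, ⟨w, hw⟩⟩ _
    rfl

theorem augmentation_comp_boundary {V : Type u} [LinearOrder V] (R : Type v) [CommRing R]
    (K : PreAbstractSimplicialComplex V) :
    K.augmentation R ∘ₗ K.boundary R 0 = 0 := by
  refine Finsupp.lhom_ext' fun s => LinearMap.ext_ring ?_
  simp only [boundary, augmentation, LinearMap.comp_apply, Finsupp.lsingle_apply,
    Finsupp.linearCombination_single, one_smul, map_sum, LinearMap.zero_apply]
  rw [← Finset.sum_smul, Finset.sum_attach s.1 (fun v => vertexSign R s.1 v)]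
  obtain ⟨a, b, hab, hs⟩ := Finset.card_eq_two.mp s.2.2
  have ha : a ∈ s.1 := by rw [hs]; simp
  have hb : b ∈ s.1 := by rw [hs]; simp
  have h := vertexSign_mul_antisymm R s.1 ha hb hab
  have h1 : s.1.erase a = {b} := by rw [hs]; ext x; simp; grind
  have h2 : s.1.erase b = {a} := by rw [hs]; ext x; simp; grind
  have h3 : ∀ x : V, vertexSign R {x} x = 1 := fun x => by
    simp [vertexSign, Finset.filter_singleton]
  rw [h1, h2, h3, h3, mul_one, mul_one] at h
  rw [hs, Finset.sum_pair hab, ← hs, h, zero_smul]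

/-- The simplicial chain complex `⋯ → C₁ → C₀` of `K`: `Cₙ` is free on the `n`-simplices. -/
noncomputable def chainComplex {V : Type u} [LinearOrder V] (R : Type v) [CommRing R]
    (K : PreAbstractSimplicialComplex V) : ChainComplex (ModuleCat.{max u v} R) ℕ :=
  ChainComplex.of (fun n => ModuleCat.of R (K.Simplex n →₀ R))
    (fun n => ModuleCat.ofHom (K.boundary R n))
    (fun n => by rw [← ModuleCat.ofHom_comp, boundary_comp_boundary]; rfl)

theorem chainComplex_d {V : Type u} [LinearOrder V] (R : Type v) [CommRing R]
    (K : PreAbstractSimplicialComplex V) (n : ℕ) :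
    (K.chainComplex R).d (n + 1) n = ModuleCat.ofHom (K.boundary R n) := by
  dsimp only [chainComplex]
  exact ChainComplex.of_d (fun n => ModuleCat.of R (K.Simplex n →₀ R))
    (fun n => ModuleCat.ofHom (K.boundary R n)) n

/-- The augmented simplicial chain complex `⋯ → C₁ → C₀ → R`, with `R` placed in index `0` and
`Cₙ` in index `n + 1`. -/
noncomputable def augmentedChainComplex {V : Type u} [LinearOrder V] (R : Type v) [CommRing R]
    (K : PreAbstractSimplicialComplex V) : ChainComplex (ModuleCat.{max u v} R) ℕ :=
  ChainComplex.augment (K.chainComplex R) (X := ModuleCat.of R (ULift.{max u v} R))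
    (ModuleCat.ofHom (K.augmentation R)) (by
      rw [chainComplex_d]
      exact ModuleCat.hom_ext (K.augmentation_comp_boundary R))

/-- Simplicial homology `Hₙ(K; R)`. -/
noncomputable abbrev simplicialHomology {V : Type u} [LinearOrder V] (R : Type v) [CommRing R]
    (K : PreAbstractSimplicialComplex V) (n : ℕ) : ModuleCat.{max u v} R :=
  (K.chainComplex R).homology n

/-- `K` has trivial reduced homology (with coefficients in `R`) in all degrees `-1, 0, 1, …`;
reduced homology in degree `n - 1` is the homology of the augmented chain complex at index `n`. -/
def HasTrivialReducedHomology {V : Type u} [LinearOrder V] (R : Type v) [CommRing R]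
    (K : PreAbstractSimplicialComplex V) : Prop :=
  ∀ n : ℕ, Limits.IsZero ((K.augmentedChainComplex R).homology n)

/-- The intersection `⋂ j ∈ J, U j` of the members of a family of complexes indexed by a finite
set `J` (meant for nonempty `J`). -/
def finiteInter {V I : Type*} (U : I → PreAbstractSimplicialComplex V) (J : Finset I) :
    PreAbstractSimplicialComplex V where
  faces := {s | s.Nonempty ∧ ∀ j ∈ J, s ∈ U j}
  isRelLowerSet_faces := fun _ hs =>
    ⟨hs.1, fun _ hts ht => ⟨ht, fun j hj => ((U j).isRelLowerSet_faces (hs.2 j hj)).2 hts ht⟩⟩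

/-- The nerve of a family of complexes `U i`: its simplices are the nonempty finite sets `J` of
indices for which the intersection `⋂ j ∈ J, U j` is nonempty, that is, has a simplex. -/
def nerve {V I : Type*} (U : I → PreAbstractSimplicialComplex V) :
    PreAbstractSimplicialComplex I where
  faces := {J | J.Nonempty ∧ ∃ s, s ∈ finiteInter U J}
  isRelLowerSet_faces := fun _ hJ =>
    ⟨hJ.1, fun _ hLJ hL => ⟨hL, hJ.2.imp fun _ hs => ⟨hs.1, fun j hj => hs.2 j (hLJ hj)⟩⟩⟩

end PreAbstractSimplicialComplex

/-! Take all pairs (J, s) of finite sets, either one possibly empty, such that s is contained in a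
simplex of X lying in every U_j with j ∈ J (`incidence`). Graded by |J| + |s|, they span a double
complex with total differential ∂ ⊗ 1 ± 1 ⊗ ∂. If X is nonempty, the row J = ∅ is the augmented
chain complex of X and the column s = ∅ is that of the nerve.

Every other row is the augmented complex of the intersection of the U_j: exact by hypothesis, or
zero if the intersection is empty. Every other column is zero unless s is a simplex of X, and is
then the augmented complex of the full simplex on {i : s ∈ U_i}. That index set is nonempty because
the U_i cover X, so coning from one of its elements shows exactness.

In a filtration by |J| or by |s|, exactness away from degree 0 lets any relevant chain be pushed
onto the edge by subtracting boundaries, so the edge has the homology of the total complex. This is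
`FilteredDifferential.homology_equiv`, applied once in each direction; composing the two
isomorphisms compares X with the nerve.

The empty set has degree 0, so dimension n sits in degree n + 1. `cycles` permits a boundary in
degree 0, which discards the augmentation and yields unreduced homology, H_0 included. This is
harmless because the only pair of degree 0, (∅, ∅), lies on both edges. -/

namespace NerveLemma

open PreAbstractSimplicialComplex

/-! ### Filtered differentials on free modules and their edge homology -/

section Algebra

variable {R : Type*} [CommRing R]

/-- The quotient of a submodule `Z` by the part of `B` that lies in `Z`. -/
abbrev Subquotient {M : Type*} [AddCommGroup M] [Module R M] (Z B : Submodule R M) :=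
  Z ⧸ B.submoduleOf Z

/-- The equivalence in `hB` says that the kernel of Z → Z'/B' is exactly the part of B in Z, giving
well-definedness and injectivity together; `hsurj` gives surjectivity. The first isomorphism theorem
does the rest. -/
theorem nonempty_subquotient_equiv {M N : Type*} [AddCommGroup M] [Module R M] [AddCommGroup N]
    [Module R N] (f : M →ₗ[R] N) {Z B : Submodule R M} {Z' B' : Submodule R N}
    (hZ : ∀ z ∈ Z, f z ∈ Z') (hB : ∀ z ∈ Z, f z ∈ B' ↔ z ∈ B)
    (hsurj : ∀ z' ∈ Z', ∃ z ∈ Z, z' - f z ∈ B') :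
    Nonempty (Subquotient Z B ≃ₗ[R] Subquotient Z' B') := by
  let g : Z →ₗ[R] (Z' ⧸ B'.submoduleOf Z') := (B'.submoduleOf Z').mkQ ∘ₗ f.restrict hZ
  have hg : Function.Surjective g := by
    intro y
    obtain ⟨⟨z', hz'⟩, rfl⟩ := (B'.submoduleOf Z').mkQ_surjective y
    obtain ⟨z, hz, h⟩ := hsurj z' hz'
    refine ⟨⟨z, hz⟩, Eq.symm ?_⟩
    exact (Submodule.Quotient.eq (B'.submoduleOf Z')).mpr h
  have hk : LinearMap.ker g = B.submoduleOf Z := by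
    ext ⟨z, hz⟩
    refine Iff.trans (Submodule.Quotient.mk_eq_zero (B'.submoduleOf Z')) ?_
    exact hB z hz
  exact ⟨(Submodule.quotEquivOfEq _ _ hk).symm ≪≫ₗ g.quotKerEquivOfSurjective hg⟩

/-- The chains of a differential `D` on a free module, supported on the basis elements in `K`
of degree `n + 1`, whose boundary has degree `0`. -/
noncomputable def cycles {T : Type*} (D : (T →₀ R) →ₗ[R] (T →₀ R)) (deg : T → ℕ) (K : Set T) (n : ℕ) :
    Submodule R (T →₀ R) :=
  Finsupp.supported R R {t | t ∈ K ∧ deg t = n + 1} ⊓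
    (Finsupp.supported R R {t | deg t = 0}).comap D

/-- The boundaries of the chains supported on the basis elements in `K` of degree `n + 2`. -/
noncomputable def boundaries {T : Type*} (D : (T →₀ R) →ₗ[R] (T →₀ R)) (deg : T → ℕ) (K : Set T) (n : ℕ) :
    Submodule R (T →₀ R) :=
  (Finsupp.supported R R {t | t ∈ K ∧ deg t = n + 2}).map D

/-- The homology of the complex spanned by the basis elements in `K`, in degree `n + 1`. -/
abbrev Homology {T : Type*} (D : (T →₀ R) →ₗ[R] (T →₀ R)) (deg : T → ℕ) (K : Set T) (n : ℕ) :=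
  Subquotient (cycles D deg K n) (boundaries D deg K n)

variable {P Q T : Type*}

/-- The component at `x` of a chain on `P × Q`. -/
noncomputable def comp (e : P × Q ≃ T) (x : P) : (T →₀ R) →ₗ[R] (Q →₀ R) :=
  Finsupp.lcomapDomain (fun y => e (x, y)) (e.injective.comp (Prod.mk_right_injective x))

@[simp]
theorem comp_apply (e : P × Q ≃ T) (x : P) (w : T →₀ R) (y : Q) :
    comp e x w y = w (e (x, y)) := rfl

/-- The chain on `P × Q` concentrated at `x`. -/
noncomputable def incl (R : Type*) [CommRing R] (e : P × Q ≃ T) (x : P) :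
    (Q →₀ R) →ₗ[R] (T →₀ R) :=
  Finsupp.lmapDomain R R (fun y => e (x, y))

theorem incl_apply (e : P × Q ≃ T) (x : P) (v : Q →₀ R) (y : Q) :
    incl R e x v (e (x, y)) = v y :=
  Finsupp.mapDomain_apply (f := fun y => e (x, y))
    (e.injective.comp (Prod.mk_right_injective x)) v y

theorem incl_apply_of_ne (e : P × Q ≃ T) {x x' : P} (h : x' ≠ x) (v : Q →₀ R) (y : Q) :
    incl R e x v (e (x', y)) = 0 := by
  refine Finsupp.mapDomain_of_notMem_range _ _ ?_
  rintro ⟨z, hz⟩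
  exact h (congrArg Prod.fst (e.injective hz)).symm

theorem comp_incl (e : P × Q ≃ T) (x : P) (v : Q →₀ R) : comp e x (incl R e x v) = v := by
  ext y
  rw [comp_apply, incl_apply]

theorem comp_incl_of_ne (e : P × Q ≃ T) {x x' : P} (h : x' ≠ x) (v : Q →₀ R) :
    comp e x' (incl R e x v) = 0 := by
  ext y
  rw [comp_apply, incl_apply_of_ne e h]
  rfl

theorem incl_injective (e : P × Q ≃ T) (x : P) : Function.Injective (incl R e x) :=
  Function.LeftInverse.injective (comp_incl e x)

theorem ext_comp (e : P × Q ≃ T) {w w' : T →₀ R} (h : ∀ x, comp e x w = comp e x w') :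
    w = w' := by
  ext t
  obtain ⟨⟨x, y⟩, rfl⟩ := e.surjective t
  rw [← comp_apply, h, comp_apply]

theorem mem_supported_iff {S : Set T} {w : T →₀ R} :
    w ∈ Finsupp.supported R R S ↔ ∀ t, w t ≠ 0 → t ∈ S := by
  rw [Finsupp.mem_supported]
  exact ⟨fun h t ht => h (Finsupp.mem_support_iff.mpr ht),
    fun h t ht => h t (Finsupp.mem_support_iff.mp ht)⟩

theorem supported_of_forall {S S' : Set T} {w : T →₀ R} (hw : w ∈ Finsupp.supported R R S)
    (h : ∀ t ∈ S, t ∈ S') : w ∈ Finsupp.supported R R S' :=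
  Finsupp.supported_mono h hw

theorem comp_mem_supported (e : P × Q ≃ T) (x : P) {S : Set T} {w : T →₀ R}
    (hw : w ∈ Finsupp.supported R R S) :
    comp e x w ∈ Finsupp.supported R R {y | e (x, y) ∈ S} := by
  rw [mem_supported_iff] at hw ⊢
  exact fun y hy => hw _ hy

theorem incl_mem_supported (e : P × Q ≃ T) (x : P) {S : Set T} {v : Q →₀ R}
    (hv : v ∈ Finsupp.supported R R {y | e (x, y) ∈ S}) :
    incl R e x v ∈ Finsupp.supported R R S := by
  rw [mem_supported_iff] at hv ⊢
  intro t ht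
  obtain ⟨⟨x', y⟩, rfl⟩ := e.surjective t
  by_cases h : x' = x
  · subst h
    rw [incl_apply] at ht
    exact hv y ht
  · exact absurd (incl_apply_of_ne e h v y) ht

/-- The data relating a differential `D` on a free module with basis `P × Q` to a differential
`δ` on the fibres: `D` is filtered by the degree on `P`, and is `± δ` on the graded pieces. -/
structure FilteredDifferential (e : P × Q ≃ T) (dP : P → ℕ) (dQ : Q → ℕ)
    (D : (T →₀ R) →ₗ[R] (T →₀ R)) (δ : (Q →₀ R) →ₗ[R] (Q →₀ R)) (W : Set T) (p₀ : P) :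
    Prop where
  sq_zero : ∀ w, D (D w) = 0
  comp_top : ∀ x, ∃ c : Rˣ, ∀ w : T →₀ R, (∀ y, dP x < dP y → comp e y w = 0) →
    comp e x (D w) = c • δ (comp e x w)
  incl_base : ∀ a, D (incl R e p₀ a) = incl R e p₀ (δ a)
  degree_eq_zero : ∀ p, dP p = 0 ↔ p = p₀
  maps : ∀ m, ∀ w ∈ Finsupp.supported R R
      {t | t ∈ W ∧ dP (e.symm t).1 + dQ (e.symm t).2 = m + 1},
    D w ∈ Finsupp.supported R R {t | t ∈ W ∧ dP (e.symm t).1 + dQ (e.symm t).2 = m}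
  exact : ∀ x, 0 < dP x → ∀ m, ∀ z ∈ Finsupp.supported R R {y | e (x, y) ∈ W ∧ dQ y = m},
    δ z = 0 → ∃ u ∈ Finsupp.supported R R {y | e (x, y) ∈ W ∧ dQ y = m + 1}, δ u = z

namespace FilteredDifferential

variable {e : P × Q ≃ T} {dP : P → ℕ} {dQ : Q → ℕ} {D : (T →₀ R) →ₗ[R] (T →₀ R)}
  {δ : (Q →₀ R) →ₗ[R] (Q →₀ R)} {W : Set T} {p₀ : P}

/-- One step down the filtration. On the top piece D acts as a unit times δ, so the top components
of w are δ-cycles; exactness of the fibres writes them as δ-boundaries, and these assemble into u.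
-/
theorem exists_lower (h : FilteredDifferential e dP dQ D δ W p₀) (m p : ℕ) (w : T →₀ R)
    (hw : w ∈ Finsupp.supported R R {t | t ∈ W ∧ dP (e.symm t).1 + dQ (e.symm t).2 = m})
    (hp : ∀ x, p + 1 < dP x → comp e x w = 0) (hD : ∀ x, p < dP x → comp e x (D w) = 0) :
    ∃ u ∈ Finsupp.supported R R {t | t ∈ W ∧ dP (e.symm t).1 + dQ (e.symm t).2 = m + 1},
      ∀ x, p < dP x → comp e x (w - D u) = 0 := by
  classical
  have key : ∀ x, ∃ v : Q →₀ R, (dP x = p + 1 →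
      v ∈ Finsupp.supported R R {y | e (x, y) ∈ W ∧ dP x + dQ y = m + 1} ∧
      ∀ w' : T →₀ R, (∀ y, dP x < dP y → comp e y w' = 0) → comp e x w' = v →
        comp e x (D w') = comp e x w) := by
    intro x
    by_cases hx : dP x = p + 1
    swap
    · exact ⟨0, fun h => absurd h hx⟩
    obtain ⟨c, hc⟩ := h.comp_top x
    have h0 : δ (comp e x w) = 0 := by
      have := hc w (fun y hy => hp y (hx ▸ hy))
      rw [hD x (by omega)] at this
      exact ((smul_eq_zero_iff_eq c).mp this.symm)
    have hs := comp_mem_supported e x hw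
    simp only [Set.mem_ofPred_eq, Equiv.symm_apply_apply] at hs
    -- The fibre degree is m - dP x in truncated subtraction; if dP x > m, the component of w at x
    -- vanishes for degree reasons.
    by_cases hm : dP x ≤ m
    · obtain ⟨u, hu, hu'⟩ := h.exact x (by omega) (m - dP x) (comp e x w)
        (supported_of_forall hs fun y hy => ⟨hy.1, by have := hy.2; omega⟩) h0
      -- The factor c⁻¹ cancels the unit by which D differs from δ at x.
      refine ⟨c⁻¹ • u, fun _ => ⟨?_, fun w' hw' hv => ?_⟩⟩
      · refine Submodule.smul_of_tower_mem _ _ (supported_of_forall hu fun y hy => ⟨hy.1, ?_⟩)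
        have := hy.2
        omega
      · rw [hc w' hw', hv, Units.smul_def, Units.smul_def, map_smul, hu', smul_smul]
        simp
    · have h1 : comp e x w = 0 := by
        rw [mem_supported_iff] at hs
        ext y
        by_contra hy
        have := (hs y hy).2
        omega
      refine ⟨0, fun _ => ⟨Submodule.zero_mem _, fun w' hw' hv => ?_⟩⟩
      rw [hc w' hw', hv, h1, map_zero, smul_zero]
  choose v hv using key
  -- Only finitely many x meet the support of w, so the local solutions can be summed even when P is
  -- infinite.
  let S : Finset P := (w.support.image (fun t => (e.symm t).1)).filter (fun x => dP x = p + 1)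
  let u : T →₀ R := ∑ x ∈ S, incl R e x (v x)
  have hu : ∀ x, comp e x u = if x ∈ S then v x else 0 := by
    intro x
    simp only [u, map_sum]
    split_ifs with hx
    · rw [Finset.sum_eq_single x, comp_incl]
      · exact fun b _ hb => comp_incl_of_ne e hb.symm _
      · exact fun h => absurd hx h
    · exact Finset.sum_eq_zero fun b hb =>
        comp_incl_of_ne e (fun hbx => hx (by rw [hbx]; exact hb)) _
  have hS : ∀ x ∈ S, dP x = p + 1 := fun x hx => (Finset.mem_filter.mp hx).2
  have htop : ∀ x, p + 1 < dP x → comp e x u = 0 := fun x hx => by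
    rw [hu, if_neg fun hx' => by have := hS x hx'; omega]
  refine ⟨u, ?_, fun x hx => ?_⟩
  · refine Submodule.sum_mem _ fun x hx => incl_mem_supported e x ?_
    simpa only [Set.mem_ofPred_eq, Equiv.symm_apply_apply] using (hv x (hS x hx)).1
  · rw [map_sub, sub_eq_zero]
    by_cases hx1 : p + 1 < dP x
    · obtain ⟨c, hc⟩ := h.comp_top x
      rw [hp x hx1, hc u fun y hy => htop y (by omega), htop x hx1, map_zero, smul_zero]
    · have hx2 : dP x = p + 1 := by omega
      have htop' : ∀ y, dP x < dP y → comp e y u = 0 := fun y hy => htop y (by omega)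
      by_cases hxS : x ∈ S
      · exact ((hv x hx2).2 u htop' (by rw [hu, if_pos hxS])).symm
      · obtain ⟨c, hc⟩ := h.comp_top x
        rw [hc u htop', hu, if_neg hxS, map_zero, smul_zero]
        ext y
        by_contra hy
        refine hxS (Finset.mem_filter.mpr ⟨Finset.mem_image.mpr ⟨e (x, y), ?_, by simp⟩, hx2⟩)
        exact Finsupp.mem_support_iff.mpr hy

/-- Iterates `exists_lower`. Since D² = 0, replacing w by w - D u leaves D w unchanged, so the
hypothesis on D w survives each step. -/
theorem exists_base (h : FilteredDifferential e dP dQ D δ W p₀) (m p : ℕ) :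
    ∀ (w : T →₀ R)
    (_ : w ∈ Finsupp.supported R R {t | t ∈ W ∧ dP (e.symm t).1 + dQ (e.symm t).2 = m})
    (_ : ∀ x, p < dP x → comp e x w = 0) (_ : ∀ x, 0 < dP x → comp e x (D w) = 0),
    ∃ u ∈ Finsupp.supported R R {t | t ∈ W ∧ dP (e.symm t).1 + dQ (e.symm t).2 = m + 1},
      ∀ x, 0 < dP x → comp e x (w - D u) = 0 := by
  induction p with
  | zero =>
    intro w _ hp _
    exact ⟨0, Submodule.zero_mem _, fun x hx => by rw [map_zero, sub_zero, hp x hx]⟩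
  | succ p ih =>
    intro w hw hp hD
    obtain ⟨u, hu, hu'⟩ := h.exists_lower m p w hw hp (fun x hx => hD x (by omega))
    obtain ⟨u₂, hu₂, hu₂'⟩ := ih (w - D u) (Submodule.sub_mem _ hw (h.maps m u hu)) hu'
      (fun x hx => by rw [map_sub, h.sq_zero, sub_zero, hD x hx])
    refine ⟨u + u₂, Submodule.add_mem _ hu hu₂, fun x hx => ?_⟩
    rw [map_add, ← sub_sub]
    exact hu₂' x hx

theorem exists_sub_eq_incl (h : FilteredDifferential e dP dQ D δ W p₀) (m : ℕ) (w : T →₀ R)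
    (hw : w ∈ Finsupp.supported R R {t | t ∈ W ∧ dP (e.symm t).1 + dQ (e.symm t).2 = m})
    (hD : ∀ x, 0 < dP x → comp e x (D w) = 0) :
    ∃ u ∈ Finsupp.supported R R {t | t ∈ W ∧ dP (e.symm t).1 + dQ (e.symm t).2 = m + 1},
      ∃ a ∈ Finsupp.supported R R {y | e (p₀, y) ∈ W ∧ dQ y = m}, w - D u = incl R e p₀ a := by
  have h0 : dP p₀ = 0 := (h.degree_eq_zero p₀).mpr rfl
  -- The induction starts from the largest filtration degree in the finite support of w.
  obtain ⟨u, hu, hu'⟩ := h.exists_base m (w.support.sup fun t => dP (e.symm t).1) w hw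
    (fun x hx => by
      ext y
      by_contra hy
      have := Finset.le_sup (f := fun t => dP (e.symm t).1) (Finsupp.mem_support_iff.mpr hy)
      simp only [Equiv.symm_apply_apply] at this
      omega) hD
  refine ⟨u, hu, comp e p₀ (w - D u), ?_, ext_comp e fun x => ?_⟩
  · have := comp_mem_supported e p₀ (Submodule.sub_mem _ hw (h.maps m u hu))
    simpa only [Set.mem_ofPred_eq, Equiv.symm_apply_apply, h0, zero_add] using this
  · by_cases hx : x = p₀
    · rw [hx, comp_incl]
    · rw [comp_incl_of_ne e hx]
      exact hu' x (Nat.pos_of_ne_zero fun h' => hx ((h.degree_eq_zero x).mp h'))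

/-- Inclusion of the edge is the isomorphism. Pushing a total cycle onto the edge gives
surjectivity; pushing a total chain that bounds an edge cycle gives injectivity. `hK` concerns only
positive degrees because the faces of a complex omit the empty set. -/
theorem homology_equiv (h : FilteredDifferential e dP dQ D δ W p₀) (K : Set Q)
    (hK : ∀ y, 0 < dQ y → (y ∈ K ↔ e (p₀, y) ∈ W)) (n : ℕ) :
    Nonempty (Homology δ dQ K n ≃ₗ[R]
      Homology D (fun t => dP (e.symm t).1 + dQ (e.symm t).2) W n) := by
  have h0 : dP p₀ = 0 := (h.degree_eq_zero p₀).mpr rfl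
  have hset : ∀ m, {y | y ∈ K ∧ dQ y = m + 1} = {y | e (p₀, y) ∈ W ∧ dQ y = m + 1} := by
    intro m
    ext y
    constructor
    · exact fun hy => ⟨(hK y (by rw [hy.2]; omega)).mp hy.1, hy.2⟩
    · exact fun hy => ⟨(hK y (by rw [hy.2]; omega)).mpr hy.1, hy.2⟩
  have hincl : ∀ m, ∀ a ∈ Finsupp.supported R R {y | e (p₀, y) ∈ W ∧ dQ y = m},
      incl R e p₀ a ∈ Finsupp.supported R R
        {t | t ∈ W ∧ dP (e.symm t).1 + dQ (e.symm t).2 = m} := by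
    intro m a ha
    refine incl_mem_supported e p₀ ?_
    simpa only [Set.mem_ofPred_eq, Equiv.symm_apply_apply, h0, zero_add] using ha
  have hbase : ∀ a, ∀ x, 0 < dP x → comp e x (incl R e p₀ a : T →₀ R) = 0 := fun a x hx =>
    comp_incl_of_ne e (fun h' => by rw [h', h0] at hx; omega) a
  have hzero : ∀ a : Q →₀ R, incl R e p₀ a ∈ Finsupp.supported R R
        {t | dP (e.symm t).1 + dQ (e.symm t).2 = 0} ↔
      a ∈ Finsupp.supported R R {y | dQ y = 0} := by
    intro a
    constructor
    · intro ha
      have := comp_mem_supported e p₀ ha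
      simpa only [comp_incl, Set.mem_ofPred_eq, Equiv.symm_apply_apply, h0, zero_add] using this
    · intro ha
      refine incl_mem_supported e p₀ ?_
      simpa only [Set.mem_ofPred_eq, Equiv.symm_apply_apply, h0, zero_add] using ha
  refine nonempty_subquotient_equiv (incl R e p₀) ?_ ?_ ?_
  · rintro z ⟨hz, hz'⟩
    rw [hset] at hz
    refine ⟨hincl _ z hz, ?_⟩
    rw [SetLike.mem_coe, Submodule.mem_comap, h.incl_base]
    exact (hzero _).mpr hz'
  · rintro z ⟨hz, -⟩
    rw [hset] at hz
    constructor
    · rintro ⟨w, hw, hwz⟩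
      obtain ⟨u, -, a, ha, hua⟩ := h.exists_sub_eq_incl (n + 2) w hw
        (fun x hx => by rw [hwz, hbase z x hx])
      refine ⟨a, by rw [hset]; exact ha, incl_injective e p₀ ?_⟩
      rw [← h.incl_base, ← hua, map_sub, h.sq_zero, sub_zero, hwz]
    · rintro ⟨a, ha, rfl⟩
      rw [hset] at ha
      exact ⟨incl R e p₀ a, hincl _ a ha, h.incl_base a⟩
  · rintro w ⟨hw, hw'⟩
    -- D w lives in total degree 0, whereas every basis element off the edge has positive degree.
    have hDw : ∀ x, 0 < dP x → comp e x (D w) = 0 := by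
      intro x hx
      ext y
      by_contra hy
      have := mem_supported_iff.mp hw' _ hy
      simp only [Set.mem_ofPred_eq, Equiv.symm_apply_apply] at this
      omega
    obtain ⟨u, hu, a, ha, hua⟩ := h.exists_sub_eq_incl (n + 1) w hw hDw
    refine ⟨a, ⟨by rw [hset]; exact ha, ?_⟩, ⟨u, hu, ?_⟩⟩
    · refine Submodule.mem_comap.mpr ((hzero (δ a)).mp ?_)
      rw [← h.incl_base, ← hua, map_sub, h.sq_zero, sub_zero]
      exact hw'
    · rw [← hua, sub_sub_cancel]

end FilteredDifferential

end Algebra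

/-! ### Tensor products of chains -/

section Pairing

variable {R : Type*} [CommRing R] {P Q T N : Type*} [AddCommGroup N] [Module R N]

theorem map_mem_of_supported {f : (T →₀ R) →ₗ[R] N} {S : Set T} {L : Submodule R N}
    (h : ∀ t ∈ S, f (Finsupp.single t 1) ∈ L) {w : T →₀ R} (hw : w ∈ Finsupp.supported R R S) :
    f w ∈ L := by
  rw [mem_supported_iff] at hw
  rw [← Finsupp.sum_single w, map_finsuppSum]
  refine Submodule.sum_mem _ fun t ht => ?_
  beta_reduce
  rw [← Finsupp.smul_single_one, map_smul]
  exact L.smul_mem _ (h t (hw t (Finsupp.mem_support_iff.mp ht)))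

theorem map_eq_of_supported {f g : (T →₀ R) →ₗ[R] N} {S : Set T}
    (h : ∀ t ∈ S, f (Finsupp.single t 1) = g (Finsupp.single t 1)) {w : T →₀ R}
    (hw : w ∈ Finsupp.supported R R S) : f w = g w := by
  have := map_mem_of_supported (f := f - g) (L := ⊥)
    (fun t ht => by rw [Submodule.mem_bot, LinearMap.sub_apply, h t ht, sub_self]) hw
  rwa [Submodule.mem_bot, LinearMap.sub_apply, sub_eq_zero] at this

theorem map_eq_of_single {f g : (T →₀ R) →ₗ[R] N}
    (h : ∀ t, f (Finsupp.single t 1) = g (Finsupp.single t 1)) (w : T →₀ R) : f w = g w :=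
  map_eq_of_supported (S := Set.univ) (fun t _ => h t) (by simp [Finsupp.supported_univ])

theorem map_map_eq_zero_of_single {D : (T →₀ R) →ₗ[R] (T →₀ R)}
    (h : ∀ t, D (D (Finsupp.single t 1)) = 0) (w : T →₀ R) : D (D w) = 0 := by
  have := map_eq_of_single (f := D ∘ₗ D) (g := 0)
    (fun t => by rw [LinearMap.comp_apply, h, LinearMap.zero_apply]) w
  rwa [LinearMap.comp_apply, LinearMap.zero_apply] at this

/-- The tensor product of chains on `P` and on `Q`, as a chain on `P × Q`. -/
noncomputable def pairing : (P →₀ R) →ₗ[R] (Q →₀ R) →ₗ[R] (P × Q →₀ R) :=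
  Finsupp.linearCombination R fun p => incl R (Equiv.refl (P × Q)) p

theorem pairing_single_left (p : P) (c : Q →₀ R) :
    pairing (Finsupp.single p 1) c = incl R (Equiv.refl (P × Q)) p c := by
  simp [pairing]

theorem pairing_single_single (p : P) (q : Q) :
    pairing (Finsupp.single p (1 : R)) (Finsupp.single q 1) = Finsupp.single (p, q) 1 := by
  rw [pairing_single_left, incl, Finsupp.lmapDomain_apply, Finsupp.mapDomain_single]
  rfl

theorem pairing_single_right (q : Q) (a : P →₀ R) :
    pairing a (Finsupp.single q 1) = incl R (Equiv.prodComm Q P) q a := by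
  refine map_eq_of_single (f := (pairing (R := R)).flip (Finsupp.single q 1)) (fun p => ?_) a
  rw [LinearMap.flip_apply, pairing_single_single, incl, Finsupp.lmapDomain_apply,
    Finsupp.mapDomain_single]
  rfl

theorem pairing_apply (a : P →₀ R) (c : Q →₀ R) (p : P) (q : Q) :
    pairing a c (p, q) = a p * c q := by
  classical
  refine map_eq_of_single (f := Finsupp.lapply (p, q) ∘ₗ (pairing (R := R)).flip c)
    (g := (LinearMap.mulRight R (c q)) ∘ₗ Finsupp.lapply p) (fun p' => ?_) a
  simp only [LinearMap.comp_apply, LinearMap.flip_apply, pairing_single_left,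
    Finsupp.lapply_apply, LinearMap.mulRight_apply]
  by_cases h : p = p'
  · subst h
    rw [Finsupp.single_eq_same, one_mul]
    exact incl_apply (Equiv.refl (P × Q)) p c q
  · rw [Finsupp.single_eq_of_ne h, zero_mul]
    exact incl_apply_of_ne (Equiv.refl (P × Q)) h c q

theorem comp_refl_pairing (a : P →₀ R) (c : Q →₀ R) (p : P) :
    comp (Equiv.refl (P × Q)) p (pairing a c) = a p • c := by
  ext q
  exact pairing_apply a c p q

theorem comp_prodComm_pairing (a : P →₀ R) (c : Q →₀ R) (q : Q) :
    comp (Equiv.prodComm Q P) q (pairing a c) = c q • a := by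
  ext p
  exact (pairing_apply a c p q).trans (mul_comm _ _)

theorem pairing_mem_supported {a : P →₀ R} {c : Q →₀ R} {A : Set P} {C : Set Q}
    (ha : a ∈ Finsupp.supported R R A) (hc : c ∈ Finsupp.supported R R C) :
    pairing a c ∈ Finsupp.supported R R (A ×ˢ C) := by
  rw [mem_supported_iff] at ha hc ⊢
  rintro ⟨p, q⟩ h
  rw [pairing_apply] at h
  exact ⟨ha p (left_ne_zero_of_mul h), hc q (right_ne_zero_of_mul h)⟩

theorem single_mem_supported {S : Set T} {t : T} (ht : t ∈ S) (r : R) :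
    Finsupp.single t r ∈ Finsupp.supported R R S :=
  Finsupp.single_mem_supported R r ht

end Pairing

/-! ### The sign involution -/

section Parity

variable {V : Type*} (R : Type*) [CommRing R]

/-- The sign involution `s ↦ (-1) ^ |s| s`. -/
noncomputable def parity : (Finset V →₀ R) →ₗ[R] (Finset V →₀ R) :=
  Finsupp.linearCombination R fun s : Finset V => Finsupp.single s ((-1) ^ s.card)

theorem parity_single (s : Finset V) (r : R) :
    parity R (Finsupp.single s r) = Finsupp.single s (r * (-1) ^ s.card) := by
  simp [parity]

end Parity

/-! ### The boundary on all finite sets, and cones -/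

section Boundary

variable {V : Type*} [LinearOrder V] (R : Type*) [CommRing R]

/-- The simplicial boundary on the free module on all finite subsets of `V`, including the
empty one. -/
noncomputable def finsetBoundary : (Finset V →₀ R) →ₗ[R] (Finset V →₀ R) :=
  Finsupp.linearCombination R fun s : Finset V =>
    ∑ v ∈ s, Finsupp.single (s.erase v) (vertexSign R s v)

theorem finsetBoundary_single (s : Finset V) :
    finsetBoundary R (Finsupp.single s 1) =
      ∑ v ∈ s, Finsupp.single (s.erase v) (vertexSign R s v) := by
  simp [finsetBoundary]

theorem finsetBoundary_single_smul (s : Finset V) (r : R) :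
    finsetBoundary R (Finsupp.single s r) =
      ∑ v ∈ s, Finsupp.single (s.erase v) (r * vertexSign R s v) := by
  simp [finsetBoundary, Finset.smul_sum]

theorem vertexSign_mul_self (s : Finset V) (v : V) :
    vertexSign R s v * vertexSign R s v = 1 := by
  rw [vertexSign, ← mul_pow]
  simp

theorem finsetBoundary_finsetBoundary (w : Finset V →₀ R) :
    finsetBoundary R (finsetBoundary R w) = 0 := by
  refine map_map_eq_zero_of_single (fun s => ?_) w
  rw [finsetBoundary_single, map_sum]
  simp only [finsetBoundary_single_smul]
  rw [Finset.sum_sigma']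
  -- Erasing v and then w cancels against erasing w and then v.
  refine Finset.sum_involution (fun p _ => ⟨p.2, p.1⟩) ?_ ?_ ?_ ?_
  · rintro ⟨v, w⟩ h
    simp only [Finset.mem_sigma, Finset.mem_erase] at h
    simp only
    rw [Finset.erase_right_comm, ← Finsupp.single_add,
      vertexSign_mul_antisymm R s h.1 h.2.2 h.2.1.symm, Finsupp.single_zero]
  · rintro ⟨v, w⟩ h _ h'
    simp only [Finset.mem_sigma, Finset.mem_erase] at h
    exact h.2.1 (congrArg Sigma.fst h')
  · rintro ⟨v, w⟩ h
    simp only [Finset.mem_sigma, Finset.mem_erase] at h ⊢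
    exact ⟨h.2.2, h.2.1.symm, h.1⟩
  · rintro ⟨v, w⟩ _
    rfl

theorem finsetBoundary_single_mem (s : Finset V) :
    finsetBoundary R (Finsupp.single s 1) ∈
      Finsupp.supported R R {t : Finset V | t ⊆ s ∧ t.card + 1 = s.card} := by
  rw [finsetBoundary_single]
  exact Submodule.sum_mem _ fun v hv => single_mem_supported
    (Set.mem_ofPred.mpr ⟨Finset.erase_subset _ _, Finset.card_erase_add_one hv⟩) _

theorem finsetBoundary_single_apply {s t : Finset V} (h : s.card ≤ t.card) :
    finsetBoundary R (Finsupp.single s 1) t = 0 := by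
  by_contra h'
  have := (mem_supported_iff.mp (finsetBoundary_single_mem R s) t h').2
  omega

/-- The cone over a chain with apex `i`. -/
noncomputable def cone (i : V) : (Finset V →₀ R) →ₗ[R] (Finset V →₀ R) :=
  Finsupp.linearCombination R fun s : Finset V =>
    if i ∈ s then 0 else Finsupp.single (insert i s) (vertexSign R (insert i s) i)

theorem cone_single (i : V) (s : Finset V) (r : R) : cone R i (Finsupp.single s r) =
    if i ∈ s then 0 else Finsupp.single (insert i s) (r * vertexSign R (insert i s) i) := by
  simp only [cone, Finsupp.linearCombination_single]
  split_ifs <;> simp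

/-- The cone is a contracting homotopy. If i ∈ s, only the face opposite i contributes; if i ∉ s,
erasing i from the cone returns s and the other faces cancel in pairs. The empty set needs no
exception, since the complex is augmented. -/
theorem finsetBoundary_cone (i : V) (w : Finset V →₀ R) :
    finsetBoundary R (cone R i w) + cone R i (finsetBoundary R w) = w := by
  refine map_eq_of_single (f := finsetBoundary R ∘ₗ cone R i + cone R i ∘ₗ finsetBoundary R)
    (g := LinearMap.id) (fun s => ?_) w
  rw [LinearMap.add_apply, LinearMap.comp_apply, LinearMap.comp_apply, LinearMap.id_apply,
    finsetBoundary_single, map_sum, cone_single]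
  simp only [cone_single]
  by_cases hi : i ∈ s
  · rw [if_pos hi, map_zero, zero_add, Finset.sum_eq_single_of_mem i hi]
    · rw [if_neg (Finset.notMem_erase i s), Finset.insert_erase hi, vertexSign_mul_self]
    · intro v _ hv
      rw [if_pos (Finset.mem_erase.mpr ⟨hv.symm, hi⟩)]
  · rw [if_neg hi, one_mul, finsetBoundary_single_smul, Finset.sum_insert hi,
      Finset.erase_insert hi, vertexSign_mul_self, add_assoc, ← Finset.sum_add_distrib]
    refine (congrArg _ (Finset.sum_eq_zero fun v hv => ?_)).trans (add_zero _)
    have hne : i ≠ v := fun h => hi (h ▸ hv)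
    rw [if_neg fun h => hi (Finset.mem_of_mem_erase h), Finset.erase_insert_of_ne hne,
      ← Finsupp.single_add]
    have h1 := vertexSign_mul_antisymm R (insert i s) (Finset.mem_insert_self i s)
      (Finset.mem_insert_of_mem hv) hne
    rw [Finset.erase_insert hi, Finset.erase_insert_of_ne hne] at h1
    have h2 := vertexSign_mul_self R s v
    have h3 := vertexSign_mul_self R (insert i s) v
    refine (congrArg (Finsupp.single _) ?_).trans (Finsupp.single_zero _)
    -- Signs square to 1, so multiplying the antisymmetry relation by two of them moves them to the
    -- other factors.
    linear_combination (vertexSign R s v * vertexSign R (insert i s) v) * h1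
      - vertexSign R (insert i s) i * vertexSign R (insert i s) v * h2
      - vertexSign R s v * vertexSign R (insert i (s.erase v)) i * h3

theorem exists_boundary_of_cone (i : V) (p : V → Prop) (hi : p i) (m : ℕ) (z : Finset V →₀ R)
    (hz : z ∈ Finsupp.supported R R {s : Finset V | (∀ j ∈ s, p j) ∧ s.card = m})
    (hz' : finsetBoundary R z = 0) :
    ∃ u ∈ Finsupp.supported R R {s : Finset V | (∀ j ∈ s, p j) ∧ s.card = m + 1},
      finsetBoundary R u = z := by
  refine ⟨cone R i z, map_mem_of_supported (fun s hs => ?_) hz, ?_⟩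
  · rw [cone_single]
    split_ifs with h
    · exact Submodule.zero_mem _
    · refine single_mem_supported
        (Set.mem_ofPred.mpr ⟨?_, by rw [Finset.card_insert_of_notMem h, hs.2]⟩) _
      intro j hj
      rcases Finset.mem_insert.mp hj with rfl | hj
      · exact hi
      · exact hs.1 j hj
  · simpa [hz'] using finsetBoundary_cone R i z

/-- The boundary lowers cardinality by one. This anticommutation cancels the mixed terms in the
square of `totalBoundary`. -/
theorem parity_finsetBoundary (w : Finset V →₀ R) :
    parity R (finsetBoundary R w) = -finsetBoundary R (parity R w) := by
  suffices h : ∀ s, (parity R ∘ₗ finsetBoundary R) (Finsupp.single s 1) =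
      (-(finsetBoundary R ∘ₗ parity R) : (Finset V →₀ R) →ₗ[R] _) (Finsupp.single s 1) by
    have := map_eq_of_single h w
    rwa [LinearMap.neg_apply, LinearMap.comp_apply, LinearMap.comp_apply] at this
  intro s
  rw [LinearMap.neg_apply, LinearMap.comp_apply, LinearMap.comp_apply, parity_single,
    finsetBoundary_single, finsetBoundary_single_smul, map_sum, ← Finset.sum_neg_distrib]
  refine Finset.sum_congr rfl fun v hv => ?_
  rw [parity_single, ← Finsupp.single_neg, ← Finset.card_erase_add_one hv]
  congr 1
  ring

end Boundary

/-! ### The total complex and its two filtrations -/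

section Total

variable {I V : Type*} [LinearOrder I] [LinearOrder V] (R : Type*) [CommRing R]

/-- The differential of the total complex of the tensor product of two chain complexes. -/
noncomputable def totalBoundary :
    (Finset I × Finset V →₀ R) →ₗ[R] (Finset I × Finset V →₀ R) :=
  Finsupp.linearCombination R fun t =>
    pairing (finsetBoundary R (Finsupp.single t.1 1)) (Finsupp.single t.2 1) +
      pairing (parity R (Finsupp.single t.1 1)) (finsetBoundary R (Finsupp.single t.2 1))

theorem totalBoundary_pairing (a : Finset I →₀ R) (c : Finset V →₀ R) :
    totalBoundary R (pairing a c) =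
      pairing (finsetBoundary R a) c + pairing (parity R a) (finsetBoundary R c) := by
  suffices h : ∀ J c, (totalBoundary R ∘ₗ (pairing (R := R)).flip c) (Finsupp.single J 1) =
      ((pairing (R := R)).flip c ∘ₗ finsetBoundary R +
        (pairing (R := R)).flip (finsetBoundary R c) ∘ₗ parity R :
          (Finset I →₀ R) →ₗ[R] (Finset I × Finset V →₀ R)) (Finsupp.single J 1) by
    simpa only [LinearMap.comp_apply, LinearMap.add_apply, LinearMap.flip_apply] using
      map_eq_of_single (fun J => h J c) a
  intro J c
  suffices h : ∀ s, (totalBoundary R ∘ₗ pairing (R := R) (Finsupp.single J 1))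
      (Finsupp.single s 1) = (pairing (R := R) (finsetBoundary R (Finsupp.single J 1)) +
        pairing (R := R) (parity R (Finsupp.single J 1)) ∘ₗ finsetBoundary R :
          (Finset V →₀ R) →ₗ[R] (Finset I × Finset V →₀ R)) (Finsupp.single s 1) by
    simpa only [LinearMap.comp_apply, LinearMap.add_apply, LinearMap.flip_apply] using
      map_eq_of_single h c
  intro s
  rw [LinearMap.comp_apply, LinearMap.add_apply, LinearMap.comp_apply, pairing_single_single,
    totalBoundary, Finsupp.linearCombination_single, one_smul]

theorem totalBoundary_totalBoundary (w : Finset I × Finset V →₀ R) :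
    totalBoundary R (totalBoundary R w) = 0 := by
  refine map_map_eq_zero_of_single (fun t => ?_) w
  rw [← pairing_single_single,
    totalBoundary_pairing, map_add, totalBoundary_pairing, totalBoundary_pairing,
    finsetBoundary_finsetBoundary, finsetBoundary_finsetBoundary, parity_finsetBoundary]
  simp

/-- The summand ∂ ⊗ 1 strictly shrinks the index set, so it could reach J only from larger sets,
where w vanishes. The unit (-1)^|J| comes from the parity twist. -/
theorem totalBoundary_comp_refl (J : Finset I) (w : Finset I × Finset V →₀ R)
    (hw : ∀ J' : Finset I, J.card < J'.card → comp (Equiv.refl _) J' w = 0) :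
    comp (Equiv.refl _) J (totalBoundary R w) =
      ((-1 : Rˣ) ^ J.card) • finsetBoundary R (comp (Equiv.refl _) J w) := by
  rw [Units.smul_def, Units.val_pow_eq_pow_val, Units.val_neg, Units.val_one]
  have hS : w ∈ Finsupp.supported R R {t : Finset I × Finset V | t.1.card ≤ J.card} := by
    rw [mem_supported_iff]
    rintro ⟨J', s⟩ h
    by_contra h'
    exact h (DFunLike.congr_fun (hw J' (not_le.mp h')) s)
  have key : ∀ t ∈ {t : Finset I × Finset V | t.1.card ≤ J.card},
      (comp (Equiv.refl _) J ∘ₗ totalBoundary R) (Finsupp.single t 1) =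
        (((-1 : R) ^ J.card) • (finsetBoundary R ∘ₗ comp (Equiv.refl _) J) :
          (Finset I × Finset V →₀ R) →ₗ[R] (Finset V →₀ R)) (Finsupp.single t 1) := by
    rintro ⟨J', s⟩ (h : J'.card ≤ J.card)
    rw [LinearMap.smul_apply, LinearMap.comp_apply, LinearMap.comp_apply,
      ← pairing_single_single, totalBoundary_pairing, map_add, comp_refl_pairing,
      comp_refl_pairing, comp_refl_pairing, finsetBoundary_single_apply R h, zero_smul, zero_add,
      parity_single, map_smul, smul_smul, one_mul]
    congr 1
    by_cases h' : J = J'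
    · subst h'
      simp
    · rw [Finsupp.single_eq_of_ne h', Finsupp.single_eq_of_ne h', mul_zero]
  have h := map_eq_of_supported key hS
  rwa [LinearMap.smul_apply, LinearMap.comp_apply, LinearMap.comp_apply] at h

/-- Here the twisted summand shrinks the vertex set and drops out; the other one carries no sign. -/
theorem totalBoundary_comp_prodComm (s : Finset V) (w : Finset I × Finset V →₀ R)
    (hw : ∀ s' : Finset V, s.card < s'.card → comp (Equiv.prodComm _ _) s' w = 0) :
    comp (Equiv.prodComm _ _) s (totalBoundary R w) =
      finsetBoundary R (comp (Equiv.prodComm _ _) s w) := by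
  have hS : w ∈ Finsupp.supported R R {t : Finset I × Finset V | t.2.card ≤ s.card} := by
    rw [mem_supported_iff]
    rintro ⟨J, s'⟩ h
    by_contra h'
    exact h (DFunLike.congr_fun (hw s' (not_le.mp h')) J)
  have key : ∀ t ∈ {t : Finset I × Finset V | t.2.card ≤ s.card},
      (comp (Equiv.prodComm _ _) s ∘ₗ totalBoundary R) (Finsupp.single t 1) =
        (finsetBoundary R ∘ₗ comp (Equiv.prodComm _ _) s) (Finsupp.single t 1) := by
    rintro ⟨J, s'⟩ (h : s'.card ≤ s.card)
    rw [LinearMap.comp_apply, LinearMap.comp_apply,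
      ← pairing_single_single, totalBoundary_pairing, map_add, comp_prodComm_pairing,
      comp_prodComm_pairing, comp_prodComm_pairing, finsetBoundary_single_apply R h, zero_smul,
      add_zero, map_smul]
  have h := map_eq_of_supported key hS
  rwa [LinearMap.comp_apply, LinearMap.comp_apply] at h

theorem totalBoundary_incl_refl (c : Finset V →₀ R) :
    totalBoundary R (incl R (Equiv.refl (Finset I × Finset V)) ∅ c) =
      incl R (Equiv.refl _) ∅ (finsetBoundary R c) := by
  rw [← pairing_single_left, totalBoundary_pairing, ← pairing_single_left, parity_single,
    finsetBoundary_single]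
  simp

theorem totalBoundary_incl_prodComm (a : Finset I →₀ R) :
    totalBoundary R (incl R (Equiv.prodComm (Finset V) (Finset I)) ∅ a) =
      incl R (Equiv.prodComm _ _) ∅ (finsetBoundary R a) := by
  rw [← pairing_single_right, totalBoundary_pairing, ← pairing_single_right,
    finsetBoundary_single]
  simp

theorem totalBoundary_mem_supported {W : Set (Finset I × Finset V)} (hW : IsLowerSet W) (m : ℕ)
    {w : Finset I × Finset V →₀ R}
    (hw : w ∈ Finsupp.supported R R {t | t ∈ W ∧ t.1.card + t.2.card = m + 1}) :
    totalBoundary R w ∈ Finsupp.supported R R {t | t ∈ W ∧ t.1.card + t.2.card = m} := by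
  refine map_mem_of_supported ?_ hw
  rintro ⟨J, s⟩ ⟨hJs, hm⟩
  have hs := single_mem_supported (R := R) (Set.mem_singleton s) 1
  have hJ : parity R (Finsupp.single J 1) ∈ Finsupp.supported R R {J} := by
    rw [parity_single]
    exact single_mem_supported (Set.mem_singleton J) _
  rw [← pairing_single_single, totalBoundary_pairing]
  refine Submodule.add_mem _
    (supported_of_forall (pairing_mem_supported (finsetBoundary_single_mem R J) hs) ?_)
    (supported_of_forall (pairing_mem_supported hJ (finsetBoundary_single_mem R s)) ?_)
  · rintro ⟨J', s'⟩ ⟨⟨h1, h2⟩, h3 : s' = s⟩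
    subst h3
    refine ⟨hW (Prod.mk_le_mk.mpr ⟨h1, le_rfl⟩) hJs, ?_⟩
    simp only at h2 hm ⊢
    omega
  · rintro ⟨J', s'⟩ ⟨h3 : J' = J, h1, h2⟩
    subst h3
    refine ⟨hW (Prod.mk_le_mk.mpr ⟨le_rfl, h1⟩) hJs, ?_⟩
    simp only at h2 hm ⊢
    omega

end Total

/-! ### Simplicial chains as chains on finite sets -/

section Translation

variable {V : Type u} (R : Type v) [CommRing R]
  (K : PreAbstractSimplicialComplex V)

/-- The inclusion of the simplicial chains into the free module on all finite sets. -/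
noncomputable def simplexInclusion (n : ℕ) : (K.Simplex n →₀ R) →ₗ[R] (Finset V →₀ R) :=
  Finsupp.lmapDomain R R Subtype.val

theorem simplexInclusion_single (n : ℕ) (s : K.Simplex n) (r : R) :
    simplexInclusion R K n (Finsupp.single s r) = Finsupp.single s.1 r :=
  Finsupp.mapDomain_single

theorem simplexInclusion_injective (n : ℕ) : Function.Injective (simplexInclusion R K n) :=
  Finsupp.mapDomain_injective Subtype.val_injective

theorem simplexInclusion_mem (n : ℕ) (z : K.Simplex n →₀ R) :
    simplexInclusion R K n z ∈
      Finsupp.supported R R {s : Finset V | s ∈ K.faces ∧ s.card = n + 1} := by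
  refine map_mem_of_supported (R := R) (S := Set.univ) (fun s _ => ?_)
    (by simp [Finsupp.supported_univ])
  rw [simplexInclusion_single]
  exact Finsupp.single_mem_supported R 1 (Set.mem_ofPred.mpr s.2)

theorem exists_simplexInclusion_eq {n : ℕ} {w : Finset V →₀ R}
    (hw : w ∈ Finsupp.supported R R {s : Finset V | s ∈ K.faces ∧ s.card = n + 1}) :
    ∃ z, simplexInclusion R K n z = w := by
  refine LinearMap.mem_range.mp (map_mem_of_supported (f := LinearMap.id) (fun s hs => ?_) hw)
  exact ⟨Finsupp.single ⟨s, hs⟩ 1, simplexInclusion_single R K n _ _⟩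

variable [LinearOrder V]

theorem simplexInclusion_boundary (n : ℕ) (z : K.Simplex (n + 1) →₀ R) :
    simplexInclusion R K n (K.boundary R n z) =
      finsetBoundary R (simplexInclusion R K (n + 1) z) := by
  suffices h : ∀ s, (simplexInclusion R K n ∘ₗ K.boundary R n) (Finsupp.single s 1) =
      (finsetBoundary R ∘ₗ simplexInclusion R K (n + 1)) (Finsupp.single s 1) by
    simpa only [LinearMap.comp_apply] using map_eq_of_single h z
  intro s
  rw [LinearMap.comp_apply, LinearMap.comp_apply, simplexInclusion_single, finsetBoundary_single,
    boundary, Finsupp.linearCombination_single, one_smul, map_sum]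
  simp only [simplexInclusion_single]
  exact Finset.sum_attach s.1 (fun v => Finsupp.single (s.1.erase v) (vertexSign R s.1 v))

/-- Each vertex {v} has boundary ∅ with sign 1, so the boundary into degree 0 is the augmentation.
-/
theorem finsetBoundary_simplexInclusion_zero (z : K.Simplex 0 →₀ R) :
    finsetBoundary R (simplexInclusion R K 0 z) =
      Finsupp.single ∅ (K.augmentation R z).down := by
  suffices h : ∀ s, (finsetBoundary R ∘ₗ simplexInclusion R K 0) (Finsupp.single s 1) =
      (Finsupp.lsingle ∅ ∘ₗ ULift.moduleEquiv.toLinearMap ∘ₗ K.augmentation R)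
        (Finsupp.single s 1) by
    exact map_eq_of_single h z
  intro s
  obtain ⟨v, hv⟩ := Finset.card_eq_one.mp s.2.2
  simp [simplexInclusion_single, finsetBoundary_single, hv, augmentation, vertexSign,
    Finset.filter_singleton]

theorem finsetBoundary_mem_of_card_one {w : Finset V →₀ R}
    (hw : w ∈ Finsupp.supported R R {s : Finset V | s.card = 1}) :
    finsetBoundary R w ∈ Finsupp.supported R R {s : Finset V | s.card = 0} := by
  refine map_mem_of_supported (fun s hs => ?_) hw
  refine supported_of_forall (finsetBoundary_single_mem R s) fun t ht => ?_
  have h1 := ht.2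
  have h2 : s.card = 1 := hs
  rw [Set.mem_ofPred_eq]
  omega

end Translation

/-! ### Categorical homology as explicit subquotients -/

section ModuleCat

theorem nonempty_homology_equiv {R : Type v} [CommRing R] (C : ChainComplex (ModuleCat.{u} R) ℕ)
    (i j k : ℕ) (hi : (ComplexShape.down ℕ).prev j = i) (hk : (ComplexShape.down ℕ).next j = k) :
    Nonempty (C.homology j ≃ₗ[R]
      Subquotient (LinearMap.ker (C.d j k).hom) (LinearMap.range (C.d i j).hom)) := by
  refine ⟨((C.homologyIsoSc' i j k hi hk) ≪≫
    (C.sc' i j k).moduleCatHomologyIso).toLinearEquiv ≪≫ₗ Submodule.quotEquivOfEq _ _ ?_⟩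
  ext ⟨z, hz⟩
  constructor
  · rintro ⟨y, hy⟩
    exact ⟨y, congrArg Subtype.val hy⟩
  · rintro ⟨y, hy⟩
    exact ⟨y, Subtype.ext hy⟩

theorem exists_d_eq_of_isZero_homology {R : Type v} [CommRing R]
    (C : ChainComplex (ModuleCat.{u} R) ℕ)
    (i j k : ℕ) (hi : (ComplexShape.down ℕ).prev j = i) (hk : (ComplexShape.down ℕ).next j = k)
    (h : Limits.IsZero (C.homology j)) (z : C.X j) (hz : (C.d j k).hom z = 0) :
    ∃ y : C.X i, (C.d i j).hom y = z := by
  rw [← HomologicalComplex.exactAt_iff_isZero_homology, C.exactAt_iff' i j k hi hk,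
    ShortComplex.moduleCat_exact_iff] at h
  exact h z hz

variable {V : Type u} [LinearOrder V] (R : Type v) [CommRing R]
  (K : PreAbstractSimplicialComplex V)

/-- The boundary is supported in cardinality n + 1 > 0, so being supported in cardinality 0 forces
it to vanish. -/
theorem mem_cycles_succ_iff (n : ℕ) (z : K.Simplex (n + 1) →₀ R) :
    simplexInclusion R K (n + 1) z ∈ cycles (finsetBoundary R) Finset.card K.faces (n + 1) ↔
      K.boundary R n z = 0 := by
  constructor
  · rintro ⟨-, hz⟩
    refine simplexInclusion_injective R K n ?_
    rw [SetLike.mem_coe, Submodule.mem_comap, ← simplexInclusion_boundary,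
      mem_supported_iff] at hz
    have h := mem_supported_iff.mp (simplexInclusion_mem R K n (K.boundary R n z))
    rw [map_zero]
    ext s
    by_contra hs
    have h1 := hz s hs
    have h2 := (h s hs).2
    rw [Set.mem_ofPred_eq] at h1
    omega
  · intro hz
    refine ⟨simplexInclusion_mem R K (n + 1) z, ?_⟩
    rw [SetLike.mem_coe, Submodule.mem_comap, ← simplexInclusion_boundary, hz, map_zero]
    exact Submodule.zero_mem _

theorem mem_cycles_zero (z : K.Simplex 0 →₀ R) :
    simplexInclusion R K 0 z ∈ cycles (finsetBoundary R) Finset.card K.faces 0 :=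
  ⟨simplexInclusion_mem R K 0 z, finsetBoundary_mem_of_card_one R
    (supported_of_forall (simplexInclusion_mem R K 0 z) fun _ hs => hs.2)⟩

theorem mem_boundaries_iff (n : ℕ) (z : K.Simplex n →₀ R) :
    simplexInclusion R K n z ∈ boundaries (finsetBoundary R) Finset.card K.faces n ↔
      z ∈ LinearMap.range (K.boundary R n) := by
  constructor
  · rintro ⟨w, hw, hwz⟩
    obtain ⟨y, rfl⟩ := exists_simplexInclusion_eq R K hw
    refine ⟨y, simplexInclusion_injective R K n ?_⟩
    rw [simplexInclusion_boundary, hwz]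
  · rintro ⟨y, rfl⟩
    exact ⟨_, simplexInclusion_mem R K (n + 1) y, (simplexInclusion_boundary R K n y).symm⟩

theorem nonempty_simplicialHomology_equiv (n : ℕ) :
    Nonempty (K.simplicialHomology R n ≃ₗ[R]
      Homology (finsetBoundary R) Finset.card K.faces n) := by
  obtain ⟨e⟩ := nonempty_homology_equiv (K.chainComplex R) (n + 1) n
    ((ComplexShape.down ℕ).next n) (ChainComplex.prev ℕ n) rfl
  have hcyc : ∀ z : K.Simplex n →₀ R,
      simplexInclusion R K n z ∈ cycles (finsetBoundary R) Finset.card K.faces n ↔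
        ((K.chainComplex R).d n ((ComplexShape.down ℕ).next n)).hom z = 0 := by
    intro z
    cases n with
    | zero =>
      rw [(K.chainComplex R).shape _ _ (by simp)]
      exact ⟨fun _ => rfl, fun _ => mem_cycles_zero R K z⟩
    | succ n =>
      rw [ChainComplex.next_nat_succ, chainComplex_d]
      exact mem_cycles_succ_iff R K n z
  have hbd : ∀ z : K.Simplex n →₀ R,
      simplexInclusion R K n z ∈ boundaries (finsetBoundary R) Finset.card K.faces n ↔
        z ∈ LinearMap.range ((K.chainComplex R).d (n + 1) n).hom := by
    intro z
    rw [chainComplex_d]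
    exact mem_boundaries_iff R K n z
  obtain ⟨e'⟩ := nonempty_subquotient_equiv
    (Z := LinearMap.ker ((K.chainComplex R).d n ((ComplexShape.down ℕ).next n)).hom)
    (B := LinearMap.range ((K.chainComplex R).d (n + 1) n).hom)
    (Z' := cycles (finsetBoundary R) Finset.card K.faces n)
    (B' := boundaries (finsetBoundary R) Finset.card K.faces n) (simplexInclusion R K n)
    (fun z hz => (hcyc z).mpr hz) (fun z _ => hbd z)
    (fun w hw => by
      obtain ⟨z, rfl⟩ := exists_simplexInclusion_eq R K hw.1
      exact ⟨z, (hcyc z).mp hw, by rw [sub_self]; exact Submodule.zero_mem _⟩)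
  exact ⟨e ≪≫ₗ e'⟩

variable {R K}

/-- Index m of the augmented complex corresponds to sets of cardinality m, with R spanned by ∅. The
cases separate the two lowest indices, where the augmentation is involved. -/
theorem exists_finsetBoundary_eq (h : K.HasTrivialReducedHomology R) (m : ℕ)
    (z : Finset V →₀ R)
    (hz : z ∈ Finsupp.supported R R {s : Finset V | (s = ∅ ∨ s ∈ K.faces) ∧ s.card = m})
    (hz' : finsetBoundary R z = 0) :
    ∃ u ∈ Finsupp.supported R R {s : Finset V | (s = ∅ ∨ s ∈ K.faces) ∧ s.card = m + 1},
      finsetBoundary R u = z := by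
  have hpos : ∀ n, ∀ w ∈ Finsupp.supported R R
      {s : Finset V | (s = ∅ ∨ s ∈ K.faces) ∧ s.card = n + 1},
      ∃ y, simplexInclusion R K n y = w := by
    intro n w hw
    refine exists_simplexInclusion_eq R K (supported_of_forall hw fun s hs => ⟨?_, hs.2⟩)
    refine hs.1.resolve_left fun h0 => ?_
    have := hs.2
    rw [h0, Finset.card_empty] at this
    omega
  have hmem : ∀ n (y : K.Simplex n →₀ R), simplexInclusion R K n y ∈ Finsupp.supported R R
      {s : Finset V | (s = ∅ ∨ s ∈ K.faces) ∧ s.card = n + 1} := fun n y =>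
    supported_of_forall (simplexInclusion_mem R K n y) fun s hs => ⟨Or.inr hs.1, hs.2⟩
  have hd : ∀ n, (K.augmentedChainComplex R).d (n + 2) (n + 1) = (K.chainComplex R).d (n + 1) n :=
    fun n => ChainComplex.augment_d_succ_succ _ _ _ _ _
  match m with
  | 0 =>
    -- A chain of degree 0 is a multiple of ∅; vanishing in index 0 makes the augmentation
    -- surjective.
    obtain ⟨y, hy⟩ : ∃ y : K.Simplex 0 →₀ R, K.augmentation R y = ULift.up (z ∅) :=
      exists_d_eq_of_isZero_homology (K.augmentedChainComplex R) 1 0 0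
      (ChainComplex.prev ℕ 0) ChainComplex.next_nat_zero (h 0) (ULift.up (z ∅))
      (by rw [(K.augmentedChainComplex R).shape _ _ (by simp)]; rfl)
    refine ⟨_, hmem 0 y, ?_⟩
    rw [finsetBoundary_simplexInclusion_zero, hy]
    ext s
    by_cases hs : s = ∅
    · rw [hs, Finsupp.single_eq_same]
    · rw [Finsupp.single_eq_of_ne hs]
      by_contra h0
      exact hs (Finset.card_eq_zero.mp (mem_supported_iff.mp hz s (Ne.symm h0)).2)
  | 1 =>
    obtain ⟨x, rfl⟩ := hpos 0 z hz
    rw [finsetBoundary_simplexInclusion_zero, Finsupp.single_eq_zero] at hz'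
    obtain ⟨y, hy⟩ := exists_d_eq_of_isZero_homology (K.augmentedChainComplex R) 2 1 0
      (ChainComplex.prev ℕ 1) (ChainComplex.next_nat_succ 0) (h 1) x (ULift.down_injective hz')
    rw [hd, chainComplex_d] at hy
    exact ⟨_, hmem 1 y, (simplexInclusion_boundary R K 0 y).symm.trans (congrArg _ hy)⟩
  | n + 2 =>
    obtain ⟨x, rfl⟩ := hpos (n + 1) z hz
    rw [← simplexInclusion_boundary] at hz'
    have hx : K.boundary R n x = 0 := simplexInclusion_injective R K n (hz'.trans (map_zero _).symm)
    obtain ⟨y, hy⟩ := exists_d_eq_of_isZero_homology (K.augmentedChainComplex R) (n + 3) (n + 2)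
      (n + 1) (ChainComplex.prev ℕ _) (ChainComplex.next_nat_succ _) (h (n + 2)) x
      (by rw [hd, chainComplex_d]; exact hx)
    rw [hd, chainComplex_d] at hy
    exact ⟨_, hmem (n + 2) y, (simplexInclusion_boundary R K (n + 1) y).symm.trans (congrArg _ hy)⟩

end ModuleCat

/-! ### The incidence double complex of the cover -/

section Incidence

variable {V I : Type*} {R : Type*} [CommRing R]
  (X : PreAbstractSimplicialComplex V) (U : I → PreAbstractSimplicialComplex V)

/-- The pairs of a finite set of indices and a finite set of vertices such that some simplex
of `X` contains the vertices and lies in all the members of the family at these indices. -/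
def incidence : Set (Finset I × Finset V) :=
  {t | ∃ s ∈ X.faces, t.2 ⊆ s ∧ ∀ j ∈ t.1, s ∈ (U j).faces}

theorem isLowerSet_incidence : IsLowerSet (incidence X U) := by
  rintro ⟨J, s⟩ ⟨J', s'⟩ ⟨hJ, hs⟩ ⟨t, ht, hst, hJt⟩
  exact ⟨t, ht, hs.trans hst, fun j hj => hJt j (hJ hj)⟩

variable {X U}

/-- A nonempty subset of a simplex is a simplex of the same complexes, so s itself can serve as
witness. Only s = ∅ needs a larger one. -/
theorem mk_mem_incidence_iff {J : Finset I} {s : Finset V} (hs : s.Nonempty) :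
    (J, s) ∈ incidence X U ↔ s ∈ X.faces ∧ ∀ j ∈ J, s ∈ (U j).faces := by
  constructor
  · rintro ⟨t, ht, hst, hJt⟩
    exact ⟨(X.isRelLowerSet_faces ht).2 hst hs,
      fun j hj => ((U j).isRelLowerSet_faces (hJt j hj)).2 hst hs⟩
  · rintro ⟨h1, h2⟩
    exact ⟨s, h1, Finset.Subset.refl s, h2⟩

theorem mk_empty_mem_incidence_iff (hcover : X.faces = ⋃ i, (U i).faces) {J : Finset I}
    (hJ : J.Nonempty) : (J, ∅) ∈ incidence X U ↔ (finiteInter U J).faces.Nonempty := by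
  constructor
  · rintro ⟨t, ht, -, hJt⟩
    exact ⟨t, (X.isRelLowerSet_faces ht).1, hJt⟩
  · rintro ⟨t, -, hJt⟩
    obtain ⟨j, hj⟩ := hJ
    refine ⟨t, ?_, Finset.empty_subset t, hJt⟩
    rw [hcover]
    exact Set.mem_iUnion.mpr ⟨j, hJt j hj⟩

variable [LinearOrder V] [LinearOrder I]

/-- Over nonempty J the fibre is the augmented complex of the intersection, and its exactness is the
hypothesis on reduced homology. -/
theorem filteredDifferential_refl (hcover : X.faces = ⋃ i, (U i).faces)
    (hinter : ∀ J : Finset I, J.Nonempty → (finiteInter U J).faces.Nonempty →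
      (finiteInter U J).HasTrivialReducedHomology R) :
    FilteredDifferential (Equiv.refl (Finset I × Finset V)) Finset.card Finset.card
      (totalBoundary R) (finsetBoundary R) (incidence X U) ∅ where
  sq_zero := totalBoundary_totalBoundary R
  comp_top J := ⟨_, totalBoundary_comp_refl R J⟩
  incl_base := totalBoundary_incl_refl R
  degree_eq_zero _ := Finset.card_eq_zero
  maps m _ hw := totalBoundary_mem_supported R (isLowerSet_incidence X U) m hw
  exact J hJ m z hz hz' := by
    have hJ' : J.Nonempty := Finset.card_pos.mp hJ
    by_cases hne : (finiteInter U J).faces.Nonempty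
    · have hmem : ∀ s : Finset V, (J, s) ∈ incidence X U ↔
          s = ∅ ∨ s ∈ (finiteInter U J).faces := by
        intro s
        rcases s.eq_empty_or_nonempty with rfl | hs
        · simpa [hne] using mk_empty_mem_incidence_iff hcover hJ'
        · rw [mk_mem_incidence_iff hs]
          constructor
          · exact fun h => Or.inr ⟨hs, h.2⟩
          · intro h
            have h2 := (h.resolve_left hs.ne_empty).2
            obtain ⟨j, hj⟩ := hJ'
            exact ⟨by rw [hcover]; exact Set.mem_iUnion.mpr ⟨j, h2 j hj⟩, h2⟩
      simp only [Equiv.refl_apply, hmem] at hz ⊢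
      exact exists_finsetBoundary_eq (hinter J hJ' hne) m z hz hz'
    -- With empty intersection not even (J, ∅) is incident, so the fibre and hence z are zero.
    · refine ⟨0, Submodule.zero_mem _, ?_⟩
      rw [map_zero]
      ext s
      by_contra hs
      have h1 := (mem_supported_iff.mp hz s (Ne.symm hs)).1
      exact hne ((mk_empty_mem_incidence_iff hcover hJ').mp
        (isLowerSet_incidence X U (Prod.mk_le_mk.mpr ⟨le_rfl, Finset.empty_subset s⟩) h1))

/-- Over a simplex s of X the fibre consists of all finite sets of indices i with s ∈ U_i; the cover
supplies one such i as cone apex. No homological hypothesis enters. -/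
theorem filteredDifferential_prodComm (R : Type*) [CommRing R]
    (hcover : X.faces = ⋃ i, (U i).faces) :
    FilteredDifferential (Equiv.prodComm (Finset V) (Finset I)) Finset.card Finset.card
      (totalBoundary R) (finsetBoundary R) (incidence X U) ∅ where
  sq_zero := totalBoundary_totalBoundary R
  comp_top s := ⟨1, fun w hw => by rw [one_smul]; exact totalBoundary_comp_prodComm R s w hw⟩
  incl_base := totalBoundary_incl_prodComm R
  degree_eq_zero _ := Finset.card_eq_zero
  maps m w hw := by
    simp only [Equiv.prodComm_symm, Equiv.prodComm_apply, Prod.fst_swap, Prod.snd_swap,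
      add_comm (Finset.card (Prod.snd _))] at hw ⊢
    exact totalBoundary_mem_supported R (isLowerSet_incidence X U) m hw
  exact s hs m z hz hz' := by
    have hs' : s.Nonempty := Finset.card_pos.mp hs
    by_cases hX : s ∈ X.faces
    · have hi := hX
      rw [hcover] at hi
      obtain ⟨i, hi⟩ := Set.mem_iUnion.mp hi
      simp only [Equiv.prodComm_apply, Prod.swap_prod_mk, mk_mem_incidence_iff hs', hX,
        true_and] at hz ⊢
      exact exists_boundary_of_cone R i (fun j => s ∈ (U j).faces) hi m z hz hz'
    · refine ⟨0, Submodule.zero_mem _, ?_⟩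
      rw [map_zero]
      ext J
      by_contra hJ
      exact hX ((mk_mem_incidence_iff hs').mp
        (mem_supported_iff.mp hz J (Ne.symm hJ)).1).1

end Incidence

end NerveLemma

theorem mainTheorem1 {R : Type*} [CommRing R] {V I : Type*} [LinearOrder V] [LinearOrder I]
    (X : PreAbstractSimplicialComplex V) (U : I → PreAbstractSimplicialComplex V)
    (hcover : X.faces = ⋃ i, (U i).faces)
    (hinter : ∀ J : Finset I, J.Nonempty →
      (PreAbstractSimplicialComplex.finiteInter U J).faces.Nonempty →
      (PreAbstractSimplicialComplex.finiteInter U J).HasTrivialReducedHomology R) :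
    ∀ n : ℕ, Nonempty (X.simplicialHomology R n ≃ₗ[R]
      (PreAbstractSimplicialComplex.nerve U).simplicialHomology R n) := by
  intro n
  obtain ⟨e₁⟩ := NerveLemma.nonempty_simplicialHomology_equiv R X n
  obtain ⟨e₂⟩ := NerveLemma.nonempty_simplicialHomology_equiv R
    (PreAbstractSimplicialComplex.nerve U) n
  obtain ⟨e₃⟩ := (NerveLemma.filteredDifferential_refl hcover hinter).homology_equiv X.faces
    (fun s hs => by
      rw [Equiv.refl_apply, NerveLemma.mk_mem_incidence_iff (Finset.card_pos.mp hs)]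
      simp) n
  obtain ⟨e₄⟩ := (NerveLemma.filteredDifferential_prodComm R hcover).homology_equiv
    (PreAbstractSimplicialComplex.nerve U).faces
    (fun J hJ => by
      have hJ' := Finset.card_pos.mp hJ
      exact (and_iff_right hJ').trans (NerveLemma.mk_empty_mem_incidence_iff hcover hJ').symm) n
  -- Both filtrations induce the same total degree up to the order of the summands, so the two total
  -- homologies agree.
  have hdeg : (fun t : Finset I × Finset V =>
      ((Equiv.prodComm (Finset V) (Finset I)).symm t).1.card +
        ((Equiv.prodComm (Finset V) (Finset I)).symm t).2.card) =
      fun t => ((Equiv.refl (Finset I × Finset V)).symm t).1.card +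
        ((Equiv.refl (Finset I × Finset V)).symm t).2.card :=
    funext fun t => add_comm _ _
  rw [hdeg] at e₄
  exact ⟨e₁ ≪≫ₗ e₃ ≪≫ₗ e₄.symm ≪≫ₗ e₂.symm⟩
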